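/- Let $k$ be a field and $n\ge 0$, and order $\mathbf Z^n$ by the product order. A $\mathbf Z^n$-persistence module is a functor from $\mathbf Z^n$ to $k$-vector spaces; its dual is $(M^*)_z=\operatorname{Hom}_k(M_{-z},k)$, and its total dimension is $\sum_z\dim M_z$. Let $F(z)$ be the module with $F(z)_w=k$ if $z\le w$ and $0$ otherwise, with identities as structure maps wherever possible, and put $\epsilon=(1,\dots,1)$. Let $K_*$ be a simplicial $\mathbf Z^n$-filtration, i.e. complexes $K_z$ with $K_z\subseteq K_w$ for $z\le w$. Here a simplicial complex is a (possibly void) family of finite subsets of a totally ordered vertex set that is closed under passing to subsets, so that the empty simplex, of dimension $-1$, is a simplex of every non-void complex. Assume that $K=\bigcup_z K_z$ has finitely many simplices, and that $K_*$ is one-critical: for every $\sigma\in K$, including $\sigma=\emptyset$, the set $\{z : \sigma\in K_z\}$ has a least element $g(\sigma)$. Let $C_\bullet(K_*)$ be the complex of simplicial chains over $k$, with $C_d(K_*)_z$ spanned by the $d$-dimensional simplices of $K_z$ for $d\in\mathbf Z$ (the empty simplex in degree $-1$), so that $H_d(K_*)=H_d(C_\bullet(K_*))$ is reduced homology. Then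 $C_d(K_*)=\bigoplus_{\dim\sigma=d}F(g(\sigma))$. Let $N^\bullet(K_*)$ be the free cochain complex with $N^d(K_*)=\bigoplus_{\dim\sigma=d}F(-g(\sigma)+\epsilon)$ whose coboundary maps are represented in the standard bases by the transposes of the boundary matrices. Let $d\in\mathbf Z$. If $H_e(K_*)$ has finite total dimension for all $e\ge d$ (in particular, if this holds for all $e$), then there is an isomorphism of persistence modules $$H_d(K_*)\;\cong\;H^{d+n}(N^\bullet(K_*))^*.$$ These isomorphisms are natural: they can be chosen simultaneously for all such $K_*$ and $d$ so as to commute with the maps induced by every chain map $C_\bullet(K_*)\to C_\bullet(L_*)$ of complexes of persistence modules (in particular by those coming from simplicial maps $K_*\to L_*$), where $N^\bullet(L_*)\to N^\bullet(K_*)$ is represented by the transposed matrices. -/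

import Mathlib

open CategoryTheory

universe u v

noncomputable section

namespace MultiPers

/-! ### Persistence modules -/

/-- The poset `ℤⁿ` with the product order. (A type synonym, so that Mathlib regards it as a category
through this order and not as a product of categories.) -/
def Grade (n : ℕ) : Type := Fin n → ℤ

instance (n : ℕ) : AddCommGroup (Grade n) := inferInstanceAs (AddCommGroup (Fin n → ℤ))

instance (n : ℕ) : PartialOrder (Grade n) := inferInstanceAs (PartialOrder (Fin n → ℤ))

instance (n : ℕ) : IsOrderedAddMonoid (Grade n) :=
  inferInstanceAs (IsOrderedAddMonoid (Fin n → ℤ))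

/-- `ε = (1, …, 1)`. -/
def eps (n : ℕ) : Grade n := fun _ => 1

/-- `ℤⁿ`-persistence modules over `k`: functors from the poset `ℤⁿ` (product order) to
`k`-vector spaces. -/
abbrev Pers (k : Type u) [Field k] (n : ℕ) : Type _ :=
  Grade n ⥤ ModuleCat.{max u v} k

section Modules

variable {k : Type u} [Field k] {n : ℕ}

/-- `∑_z dim M_z < ∞`. -/
def FiniteTotalDim (M : Pers.{u, v} k n) : Prop :=
  (∀ z, Module.Finite k (M.obj z)) ∧ {z | Nontrivial (M.obj z)}.Finite

/-- The dual persistence module, `(M^*)_z = Hom_k(M_{-z}, k)`. -/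
def dual (M : Pers.{u, v} k n) : Pers.{u, v} k n where
  obj z := ModuleCat.of k (Module.Dual k (M.obj (-z)))
  map {z w} h := ModuleCat.ofHom
    (M.map (homOfLE (neg_le_neg (leOfHom h)) : -w ⟶ -z)).hom.dualMap
  map_id z := by
    ext f
    have : (homOfLE (neg_le_neg (leOfHom (𝟙 z))) : -z ⟶ -z) = 𝟙 (-z) := rfl
    rw [this, M.map_id]
    rfl
  map_comp {x y z} a b := by
    have : (homOfLE (neg_le_neg (leOfHom (a ≫ b))) : -z ⟶ -x) =
        homOfLE (neg_le_neg (leOfHom b)) ≫ homOfLE (neg_le_neg (leOfHom a)) := rfl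
    rw [this, M.map_comp]
    rfl

/-- The dual `f^* : N^* ⟶ M^*` of a morphism `f : M ⟶ N`. -/
def dualMap {M N : Pers.{u, v} k n} (f : M ⟶ N) : dual N ⟶ dual M where
  app z := ModuleCat.ofHom (f.app (-z)).hom.dualMap
  naturality {z w} h := by
    ext φ
    refine LinearMap.ext fun x => ?_
    have := ConcreteCategory.congr_hom
      (f.naturality (homOfLE (neg_le_neg (leOfHom h)) : -w ⟶ -z)) x
    exact congrArg (fun y => (show Module.Dual k (N.obj (-z)) from φ) y) this.symm

/-- The structure map `(⨁_{i, z ∈ U i} k) → (⨁_{i, w ∈ U i} k)` for `z ≤ w`. -/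
def sumStruct (k : Type u) [Field k] {I : Type v} (U : I → UpperSet (Grade n)) {z w : Grade n}
    (h : z ≤ w) : ({i : I // z ∈ U i} →₀ k) →ₗ[k] ({i : I // w ∈ U i} →₀ k) :=
  Finsupp.lmapDomain k k fun i => ⟨i.1, (U i.1).upper h i.2⟩

/-- The direct sum over `i : I` of the modules that are `k` on the upper set `U i` and `0`
elsewhere, with identities as structure maps on `U i`. -/
def sumModule (k : Type u) [Field k] {I : Type v} (U : I → UpperSet (Grade n)) :
    Pers.{u, v} k n where
  obj z := ModuleCat.of k ({i : I // z ∈ U i} →₀ k)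
  map h := ModuleCat.ofHom (sumStruct k U (leOfHom h))
  map_id _ := congrArg ModuleCat.ofHom (Finsupp.lmapDomain_id k k)
  map_comp {x y z} a b := congrArg ModuleCat.ofHom <|
    Finsupp.lmapDomain_comp k k
      (fun i : {i : I // x ∈ U i} =>
        (⟨i.1, (U i.1).upper (leOfHom a) i.2⟩ : {i : I // y ∈ U i}))
      (fun i => (⟨i.1, (U i.1).upper (leOfHom b) i.2⟩ : {i : I // z ∈ U i}))

/-- The free module `⨁ i, F(r i)` with basis elements of grades `r i`. -/
abbrev freeModule (k : Type u) [Field k] {I : Type v} (r : I → Grade n) : Pers.{u, v} k n :=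
  sumModule k fun i => UpperSet.Ici (r i)

theorem ici_le_ici {a b : Grade n} : UpperSet.Ici a ≤ UpperSet.Ici b ↔ a ≤ b := by
  simp

/-- The linear map given in grade `z` by the submatrix of `A` on the basis elements that are
present in grade `z`; column `j` is the image of the basis element `j`. -/
def matrixLin {I J : Type v} [Finite I] (U' : I → UpperSet (Grade n))
    (U : J → UpperSet (Grade n)) (A : Matrix I J k) (z : Grade n) :
    ({j : J // z ∈ U j} →₀ k) →ₗ[k] ({i : I // z ∈ U' i} →₀ k) :=
  Finsupp.linearCombination k fun j => Finsupp.equivFunOnFinite.symm fun i => A i.1 j.1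

theorem matrixLin_single {I J : Type v} [Finite I] (U' : I → UpperSet (Grade n))
    (U : J → UpperSet (Grade n)) (A : Matrix I J k) (z : Grade n) (j : {j : J // z ∈ U j})
    (i : {i : I // z ∈ U' i}) :
    matrixLin U' U A z (Finsupp.single j 1) i = A i.1 j.1 := by
  simp [matrixLin]

theorem matrixLin_struct {I J : Type v} [Finite I] (U' : I → UpperSet (Grade n))
    (U : J → UpperSet (Grade n)) (A : Matrix I J k)
    (hA : ∀ i j, A i j ≠ 0 → U' i ≤ U j) {z w : Grade n} (h : z ≤ w) :
    matrixLin U' U A w ∘ₗ sumStruct k U h = sumStruct k U' h ∘ₗ matrixLin U' U A z := by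
  refine Finsupp.lhom_ext' fun j => LinearMap.ext_ring (Finsupp.ext fun i => ?_)
  simp only [LinearMap.comp_apply, Finsupp.lsingle_apply, sumStruct, Finsupp.lmapDomain_apply,
    Finsupp.mapDomain_single, matrixLin_single]
  have hinj : Function.Injective fun i : {i : I // z ∈ U' i} =>
      (⟨i.1, (U' i.1).upper h i.2⟩ : {i : I // w ∈ U' i}) :=
    fun a b hab => Subtype.ext (congrArg (fun x : {i : I // w ∈ U' i} => x.1) hab)
  by_cases hi : z ∈ U' i.1
  · have := Finsupp.mapDomain_apply hinj
      (matrixLin U' U A z (Finsupp.single j 1)) ⟨i.1, hi⟩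
    rw [matrixLin_single] at this
    exact this.symm
  · rw [Finsupp.mapDomain_of_notMem_range]
    · by_contra h0
      exact hi (hA _ _ h0 j.2)
    · rintro ⟨a, rfl⟩
      exact hi a.2

theorem matrixLin_comp {I J L : Type v} [Finite I] [Fintype J] (U'' : I → UpperSet (Grade n))
    (U' : J → UpperSet (Grade n)) (U : L → UpperSet (Grade n))
    (A : Matrix J L k) (hA : ∀ i j, A i j ≠ 0 → U' i ≤ U j) (B : Matrix I J k) (z : Grade n) :
    matrixLin U'' U' B z ∘ₗ matrixLin U' U A z = matrixLin U'' U (B * A) z := by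
  classical
  refine Finsupp.lhom_ext' fun l => LinearMap.ext_ring (Finsupp.ext fun i => ?_)
  simp only [LinearMap.comp_apply, Finsupp.lsingle_apply, matrixLin_single, Matrix.mul_apply]
  conv_lhs => rw [matrixLin, Finsupp.linearCombination_apply, Finsupp.sum_fintype _ _ (by simp),
    Finsupp.finsetSum_apply]
  simp only [Finsupp.smul_apply, Finsupp.equivFunOnFinite_symm_apply_apply, smul_eq_mul,
    matrixLin_single]
  have h1 : ∑ j : {j : J // z ∈ U' j}, A j.1 l.1 * B i.1 j.1 =
      ∑ j ∈ Finset.univ.filter (fun j => z ∈ U' j), A j l.1 * B i.1 j :=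
    (Finset.sum_subtype _ (by simp) (fun j => A j l.1 * B i.1 j)).symm
  rw [h1, Finset.sum_filter]
  refine Finset.sum_congr rfl fun j _ => ?_
  split_ifs with hj
  · exact mul_comm _ _
  · have : A j l.1 = 0 := by
      by_contra h0
      exact hj (hA _ _ h0 l.2)
    rw [this, mul_zero]

/-- The morphism represented by a matrix `A` whose entry `A i j` vanishes unless `U j ⊆ U' i`
(note that `≤` on `UpperSet` is `⊇`). For free modules with basis grades `r' i` and `r j`, the
condition reads: `A i j = 0` unless `r' i ≤ r j`. -/
def matrixHom {I J : Type v} [Finite I] {U' : I → UpperSet (Grade n)}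
    {U : J → UpperSet (Grade n)} (A : Matrix I J k)
    (hA : ∀ i j, A i j ≠ 0 → U' i ≤ U j) : sumModule k U ⟶ sumModule k U' where
  app z := ModuleCat.ofHom (matrixLin U' U A z)
  naturality _ _ h := congrArg ModuleCat.ofHom (matrixLin_struct U' U A hA (leOfHom h))

theorem matrixHom_comp {I J L : Type v} [Finite I] [Fintype J] {U'' : I → UpperSet (Grade n)}
    {U' : J → UpperSet (Grade n)} {U : L → UpperSet (Grade n)}
    (A : Matrix J L k) (hA : ∀ i j, A i j ≠ 0 → U' i ≤ U j)
    (B : Matrix I J k) (hB : ∀ i j, B i j ≠ 0 → U'' i ≤ U' j)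
    (C : Matrix I L k) (hC : ∀ i j, C i j ≠ 0 → U'' i ≤ U j) (h : B * A = C) :
    matrixHom A hA ≫ matrixHom B hB = matrixHom C hC := by
  subst h
  exact NatTrans.ext (funext fun z => congrArg ModuleCat.ofHom (matrixLin_comp U'' U' U A hA B z))

theorem matrixHom_zero {I J : Type v} [Finite I] {U' : I → UpperSet (Grade n)}
    {U : J → UpperSet (Grade n)} (A : Matrix I J k)
    (hA : ∀ i j, A i j ≠ 0 → U' i ≤ U j) (h0 : A = 0) : matrixHom A hA = 0 := by
  have h1 (z : Grade n) : matrixLin U' U A z = 0 := by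
    refine Finsupp.lhom_ext' fun j => LinearMap.ext_ring (Finsupp.ext fun i => ?_)
    simp [matrixLin_single, h0]
  exact NatTrans.ext (funext fun z => congrArg ModuleCat.ofHom (h1 z))

theorem matrixHom_comp_eq_zero {I J L : Type v} [Finite I] [Fintype J]
    {U'' : I → UpperSet (Grade n)} {U' : J → UpperSet (Grade n)} {U : L → UpperSet (Grade n)}
    (A : Matrix J L k) (hA : ∀ i j, A i j ≠ 0 → U' i ≤ U j)
    (B : Matrix I J k) (hB : ∀ i j, B i j ≠ 0 → U'' i ≤ U' j) (h : B * A = 0) :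
    matrixHom A hA ≫ matrixHom B hB = 0 :=
  (matrixHom_comp A hA B hB 0 (fun _ _ h0 => absurd rfl h0) h).trans (matrixHom_zero _ _ rfl)

end Modules

/-! ### Filtrations -/

/-- A finite one-critical simplicial `ℤⁿ`-filtration. Every complex `K_z` is a family of finite
subsets of a totally ordered vertex set that is closed under passing to subsets; the empty simplex,
of dimension `-1`, belongs to every non-void complex. -/
structure Filtration (n : ℕ) where
  /-- the vertex set -/
  V : Type v
  [order : LinearOrder V]
  /-- the simplices of `K_z` -/
  cx : Grade n → Set (Finset V)
  down_closed : ∀ {z σ τ}, σ ∈ cx z → τ ⊆ σ → τ ∈ cx z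
  mono : ∀ {z w}, z ≤ w → cx z ⊆ cx w
  finite : (⋃ z, cx z).Finite
  one_critical : ∀ σ ∈ (⋃ z, cx z), ∃ g, IsLeast {z | σ ∈ cx z} g

attribute [instance] Filtration.order

namespace Filtration

variable {n : ℕ} (K : Filtration.{v} n) (k : Type u) [Field k]

/-- The `d`-dimensional simplices of `K = ⋃ z, K_z`, for `d : ℤ`. -/
@[ext]
structure Simp (d : ℤ) : Type v where
  val : Finset K.V
  mem : val ∈ (⋃ z, K.cx z)
  card_eq : (val.card : ℤ) = d + 1

instance (d : ℤ) : Finite (K.Simp d) :=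
  have := K.finite.to_subtype
  Finite.of_injective (β := (⋃ z, K.cx z : Set (Finset K.V))) (fun σ => ⟨σ.val, σ.mem⟩)
    fun _ _ h => Simp.ext (congrArg Subtype.val h)

instance (d : ℤ) : Fintype (K.Simp d) := Fintype.ofFinite _

/-- The grade `g(σ)`, the least `z` with `σ ∈ K_z`. -/
def grade {d : ℤ} (σ : K.Simp d) : Grade n := (K.one_critical σ.val σ.mem).choose

theorem grade_isLeast {d : ℤ} (σ : K.Simp d) : IsLeast {z | σ.val ∈ K.cx z} (K.grade σ) :=
  (K.one_critical σ.val σ.mem).choose_spec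

/-- The set of all `z` with `σ ∈ K_z`. -/
def presence {d : ℤ} (σ : K.Simp d) : UpperSet (Grade n) where
  carrier := {z | σ.val ∈ K.cx z}
  upper' _ _ h hz := K.mono h hz

theorem presence_eq {d : ℤ} (σ : K.Simp d) : K.presence σ = UpperSet.Ici (K.grade σ) :=
  UpperSet.ext (Set.ext fun _ =>
    ⟨fun hz => (K.grade_isLeast σ).2 hz, fun hz => K.mono hz (K.grade_isLeast σ).1⟩)

/-- The matrix of the simplicial boundary map: `∂ [x₀ < ⋯ < x_i] = ∑ₗ (-1)ˡ [x₀, …, x̂ₗ, …, x_i]`.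
It is defined for any two dimensions `i` and `j`, and it is zero unless `j = i - 1`. -/
def bd (i j : ℤ) : Matrix (K.Simp j) (K.Simp i) k := fun τ σ =>
  ∑ x ∈ σ.val, if τ.val = σ.val.erase x then (-1) ^ (σ.val.filter (· < x)).card else 0

theorem bd_ne_zero {i j : ℤ} {τ : K.Simp j} {σ : K.Simp i} (h : K.bd k i j τ σ ≠ 0) :
    ∃ x ∈ σ.val, τ.val = σ.val.erase x := by
  obtain ⟨x, hx, h⟩ := Finset.exists_ne_zero_of_sum_ne_zero h
  exact ⟨x, hx, by_contra fun h0 => h (if_neg h0)⟩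

theorem bd_shape {i j : ℤ} (h : j + 1 ≠ i) : K.bd k i j = 0 := by
  ext τ σ
  by_contra h0
  obtain ⟨x, hx, hτ⟩ := K.bd_ne_zero k h0
  have h1 := τ.card_eq
  have h2 := σ.card_eq
  have h3 := Finset.card_erase_add_one hx
  rw [← hτ] at h3
  omega

theorem bd_presence {i j : ℤ} (τ : K.Simp j) (σ : K.Simp i) (h : K.bd k i j τ σ ≠ 0) :
    K.presence τ ≤ K.presence σ := by
  obtain ⟨x, -, hτ⟩ := K.bd_ne_zero k h
  intro z hz
  exact K.down_closed hz (hτ ▸ Finset.erase_subset _ _)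

theorem bd_mul_bd (i j l : ℤ) : K.bd k j l * K.bd k i j = 0 := by
  by_cases hij : j + 1 = i
  swap
  · rw [K.bd_shape k hij, Matrix.mul_zero]
  ext ρ σ
  rw [Matrix.mul_apply, Matrix.zero_apply]
  have key : ∀ τ : K.Simp j, K.bd k j l ρ τ * K.bd k i j τ σ =
      ∑ x ∈ σ.val, if τ.val = σ.val.erase x then
        (∑ y ∈ σ.val.erase x, if ρ.val = (σ.val.erase x).erase y then
          (-1 : k) ^ ((σ.val.erase x).filter (· < y)).card else 0) *
          (-1) ^ (σ.val.filter (· < x)).card else 0 := by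
    intro τ
    rw [bd, bd, Finset.mul_sum]
    refine Finset.sum_congr rfl fun x _ => ?_
    split_ifs with h
    · rw [h]
    · rw [mul_zero]
  rw [Finset.sum_congr rfl fun τ _ => key τ, Finset.sum_comm]
  have key2 : ∀ x ∈ σ.val, (∑ τ : K.Simp j, if τ.val = σ.val.erase x then
        (∑ y ∈ σ.val.erase x, if ρ.val = (σ.val.erase x).erase y then
          (-1 : k) ^ ((σ.val.erase x).filter (· < y)).card else 0) *
          (-1) ^ (σ.val.filter (· < x)).card else 0) =
      ∑ y ∈ σ.val, if x ≠ y ∧ ρ.val = (σ.val.erase x).erase y then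
          (-1 : k) ^ (((σ.val.erase x).filter (· < y)).card + (σ.val.filter (· < x)).card) else 0 := by
    intro x hx
    have hmem : σ.val.erase x ∈ (⋃ z, K.cx z) ∧ ((σ.val.erase x).card : ℤ) = j + 1 := by
      constructor
      · obtain ⟨z, hz⟩ := Set.mem_iUnion.1 σ.mem
        exact Set.mem_iUnion.2 ⟨z, K.down_closed hz (Finset.erase_subset _ _)⟩
      · have h2 := σ.card_eq
        have h3 := Finset.card_erase_add_one hx
        omega
    rw [Finset.sum_eq_single (⟨σ.val.erase x, hmem.1, hmem.2⟩ : K.Simp j)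
      (fun τ _ hτ => if_neg fun h => hτ (Simp.ext h)) (by simp), if_pos rfl, Finset.sum_mul]
    rw [← Finset.sum_subset (Finset.erase_subset x σ.val)]
    · refine Finset.sum_congr rfl fun y hy => ?_
      have hne : x ≠ y := (Finset.ne_of_mem_erase hy).symm
      by_cases h : ρ.val = (σ.val.erase x).erase y
      · rw [if_pos h, if_pos ⟨hne, h⟩, pow_add]
      · rw [if_neg h, if_neg (fun h' => h h'.2), zero_mul]
    · intro y hy hy'
      refine if_neg fun h => hy' (Finset.mem_erase.2 ⟨h.1.symm, hy⟩)
  rw [Finset.sum_congr rfl key2, ← Finset.sum_product']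
  have sign : ∀ x y, x ∈ σ.val → x < y →
      ((σ.val.erase x).filter (· < y)).card + (σ.val.filter (· < x)).card + 1 =
        ((σ.val.erase y).filter (· < x)).card + (σ.val.filter (· < y)).card := by
    intro x y hx hxy
    have h1 : (σ.val.erase x).filter (· < y) = (σ.val.filter (· < y)).erase x :=
      Finset.filter_erase ..
    have h2 : (σ.val.erase y).filter (· < x) = σ.val.filter (· < x) := by
      rw [Finset.filter_erase, Finset.erase_eq_of_notMem]
      simp [hxy.le]
    have h3 := Finset.card_erase_add_one (s := σ.val.filter (· < y)) (a := x)
      (Finset.mem_filter.2 ⟨hx, hxy⟩)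
    rw [h1, h2]
    omega
  refine Finset.sum_involution (fun p _ => (p.2, p.1)) ?_ ?_ ?_ (fun _ _ => rfl)
  · rintro ⟨x, y⟩ hp
    obtain ⟨hx, hy⟩ := Finset.mem_product.1 hp
    dsimp only at hx hy ⊢
    by_cases h : x ≠ y ∧ ρ.val = (σ.val.erase x).erase y
    · have h' : y ≠ x ∧ ρ.val = (σ.val.erase y).erase x :=
        ⟨h.1.symm, h.2.trans Finset.erase_right_comm⟩
      rw [if_pos h, if_pos h']
      rcases lt_or_gt_of_ne h.1 with hlt | hlt
      · rw [← sign x y hx hlt, pow_succ]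
        ring
      · rw [← sign y x hy hlt, pow_succ]
        ring
    · have h' : ¬ (y ≠ x ∧ ρ.val = (σ.val.erase y).erase x) := fun h' =>
        h ⟨h'.1.symm, h'.2.trans Finset.erase_right_comm⟩
      rw [if_neg h, if_neg h', add_zero]
  · rintro ⟨x, y⟩ hp h0 heq
    refine h0 (if_neg fun h => h.1 ?_)
    exact (congrArg Prod.fst heq).symm
  · rintro ⟨x, y⟩ hp
    obtain ⟨hx, hy⟩ := Finset.mem_product.1 hp
    exact Finset.mem_product.2 ⟨hy, hx⟩

theorem bd_grade {i j : ℤ} (τ : K.Simp j) (σ : K.Simp i) (h : K.bd k i j τ σ ≠ 0) :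
    K.grade τ ≤ K.grade σ := by
  have := K.bd_presence k τ σ h
  rwa [presence_eq, presence_eq, ici_le_ici] at this

/-- The chain complex `C_•(K_*)`: in homological degree `d` and grade `z`, the vector space with
basis the `d`-dimensional simplices of `K_z` (the empty simplex in degree `-1`). -/
def chains : ChainComplex (Pers.{u, v} k n) ℤ where
  X d := sumModule k (K.presence (d := d))
  d i j := matrixHom (K.bd k i j) (K.bd_presence k)
  shape _ _ h := matrixHom_zero _ _ (K.bd_shape k h)
  d_comp_d' i j l _ _ := matrixHom_comp_eq_zero _ _ _ _ (K.bd_mul_bd k i j l)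

/-- The reduced persistent homology `H_d(K_*)`. -/
abbrev H (d : ℤ) : Pers.{u, v} k n := (K.chains k).homology d

/-- The grade `-g(σ) + ε` of the basis element of `N^•(K_*)` that corresponds to `σ`. -/
def coGrade {d : ℤ} (σ : K.Simp d) : Grade n := -K.grade σ + eps n

theorem coGrade_le {i j : ℤ} {τ : K.Simp j} {σ : K.Simp i} (h : K.grade τ ≤ K.grade σ) :
    UpperSet.Ici (K.coGrade σ) ≤ UpperSet.Ici (K.coGrade τ) :=
  ici_le_ici.2 (add_le_add_left (neg_le_neg h) _)

open Matrix in
/-- The free cochain complex `N^•(K_*)`, in degree `d` the free module `⨁ F(-g(σ) + ε)` over all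
`d`-dimensional simplices `σ` of `K`; the coboundary maps are represented by the transposes of the
boundary matrices. -/
def N : CochainComplex (Pers.{u, v} k n) ℤ where
  X d := freeModule k (K.coGrade (d := d))
  d i j := matrixHom (K.bd k j i)ᵀ fun σ τ h => K.coGrade_le (K.bd_grade k τ σ h)
  shape i j h := matrixHom_zero _ _ (by rw [K.bd_shape k h, Matrix.transpose_zero])
  d_comp_d' i j l _ _ := matrixHom_comp_eq_zero _ _ _ _
    (by rw [← Matrix.transpose_mul, K.bd_mul_bd, Matrix.transpose_zero])

end Filtration

/-- A chain map `C_•(K_*) → C_•(L_*)` of complexes of persistence modules, given by graded matrices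
with respect to the bases of simplices; for instance the one induced by a map of vertices that
carries simplices of `K_z` to simplices of `L_z` for every `z`. -/
structure ChainMap (k : Type u) [Field k] {n : ℕ} (K L : Filtration.{v} n) where
  mat : ∀ d : ℤ, Matrix (L.Simp d) (K.Simp d) k
  graded : ∀ {d : ℤ} (τ : L.Simp d) (σ : K.Simp d), mat d τ σ ≠ 0 → L.grade τ ≤ K.grade σ
  comm : ∀ i j : ℤ, L.bd k i j * mat i = mat j * K.bd k i j

namespace ChainMap

variable {k : Type u} [Field k] {n : ℕ} {K L : Filtration.{v} n} (φ : ChainMap k K L)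

/-- The morphism of complexes of persistence modules `C_•(K_*) ⟶ C_•(L_*)`. -/
def onChains : K.chains k ⟶ L.chains k where
  f d := matrixHom (φ.mat d) fun τ σ h => by
    rw [Filtration.presence_eq, Filtration.presence_eq]
    exact ici_le_ici.2 (φ.graded τ σ h)
  comm' i j _ := by
    have hc : ∀ (τ : L.Simp j) (σ : K.Simp i), (L.bd k i j * φ.mat i) τ σ ≠ 0 →
        L.presence τ ≤ K.presence σ := by
      intro τ σ h
      rw [Matrix.mul_apply] at h
      obtain ⟨ρ, -, h⟩ := Finset.exists_ne_zero_of_sum_ne_zero h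
      refine (L.bd_presence k τ ρ (left_ne_zero_of_mul h)).trans ?_
      rw [Filtration.presence_eq, Filtration.presence_eq]
      exact ici_le_ici.2 (φ.graded ρ σ (right_ne_zero_of_mul h))
    exact (matrixHom_comp _ _ _ (L.bd_presence k) _ hc rfl).trans
      (matrixHom_comp _ (K.bd_presence k) _ _ _ hc (φ.comm i j).symm).symm

open Matrix in
/-- The morphism `N^•(L_*) ⟶ N^•(K_*)` represented by the transposed matrices. -/
def onN : L.N k ⟶ K.N k where
  f d := matrixHom (φ.mat d)ᵀ fun σ τ h =>
    ici_le_ici.2 (add_le_add_left (neg_le_neg (φ.graded τ σ h)) _)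
  comm' i j _ := by
    have hc : ∀ (σ : K.Simp j) (τ : L.Simp i), (L.bd k j i * φ.mat j)ᵀ σ τ ≠ 0 →
        UpperSet.Ici (K.coGrade σ) ≤ UpperSet.Ici (L.coGrade τ) := by
      intro σ τ h
      rw [Matrix.transpose_apply, Matrix.mul_apply] at h
      obtain ⟨ρ, -, h⟩ := Finset.exists_ne_zero_of_sum_ne_zero h
      exact ici_le_ici.2 (add_le_add_left (neg_le_neg
        ((L.bd_grade k τ ρ (left_ne_zero_of_mul h)).trans
          (φ.graded ρ σ (right_ne_zero_of_mul h)))) _)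
    exact (matrixHom_comp _ _ (K.bd k j i)ᵀ (fun σ τ h => K.coGrade_le (K.bd_grade k τ σ h)) _ hc
        (by rw [← Matrix.transpose_mul, φ.comm])).trans
      (matrixHom_comp (L.bd k j i)ᵀ (fun σ τ h => L.coGrade_le (L.bd_grade k τ σ h)) _ _ _ hc
        (by rw [← Matrix.transpose_mul])).symm

end ChainMap
end MultiPers

end

/-! Keep the simplices and boundary matrices of `C_•(K_*)`, but vary where a simplex `σ` is present.
Let `O_m` be the complex in which `σ` lives in the grades `z` with `z_i < g(σ)_i` for `i < m` and
`g(σ)_i ≤ z_i` for `i ≥ m` (`Support.orthant`). Then `O_0` is the chain complex. At the other end,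
over the integers `z < g(σ)` in every coordinate means `-g(σ) + ε ≤ -z`, so `O_n` is the dual of
`N^•`. Duality over a field is exact, hence `H_e(O_n) ≅ H^e(N^•)^*`. It remains to pass from `O_n`
to `O_0`, losing one homological degree per coordinate.

Dropping the condition on coordinate `m` gives a complex `S_m` (`Support.slab`) and a short exact
sequence `0 → O_m → S_m → O_{m+1} → 0`. In grade `z`, `S_m` agrees with `O_m` in any grade obtained
from `z` by moving coordinate `m` beyond all `g(σ)_m`. There are infinitely many such grades, so
`H_e(S_m) = 0` once `H_e(O_m)` has finite support (`isZero_homology_slab`). The connecting maps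
`H_i(O_{m+1}) → H_{i-1}(O_m)` are therefore isomorphisms, and they carry finiteness of support to
the next step (`isIso_connecting`).

Naturality holds because a graded matrix acts on all these complexes at once. Its nonzero entries
never raise `g`, structure maps never lower `z`, and the supports are convex for these two
directions. So a chain map induces maps of the short exact sequences, which commute with the
connecting maps. -/

noncomputable section

namespace MultiPers

/-! ### Submatrices as linear maps between spaces of finitely supported functions -/

section Submatrix

variable {k : Type u} [Field k] {I J L : Type v}

/-- The linear map given by the submatrix of `A` with columns in `p` and rows in `q`. -/
def submatrixLin [Finite I] (p : J → Prop) (q : I → Prop) (A : Matrix I J k) :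
    ({j : J // p j} →₀ k) →ₗ[k] ({i : I // q i} →₀ k) :=
  Finsupp.linearCombination k fun j => Finsupp.equivFunOnFinite.symm fun i => A i.1 j.1

@[simp]
theorem submatrixLin_single [Finite I] (p : J → Prop) (q : I → Prop) (A : Matrix I J k)
    (j : {j : J // p j}) (i : {i : I // q i}) :
    submatrixLin p q A (Finsupp.single j 1) i = A i.1 j.1 := by
  simp [submatrixLin]

theorem submatrixLin_hom_ext [Finite I] {p : J → Prop} {q : I → Prop}
    {f g : ({j : J // p j} →₀ k) →ₗ[k] ({i : I // q i} →₀ k)}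
    (h : ∀ j i, f (Finsupp.single j 1) i = g (Finsupp.single j 1) i) : f = g :=
  Finsupp.lhom_ext' fun j => LinearMap.ext_ring (Finsupp.ext fun i => h j i)

/-- A middle index contributes to an entry of `B * A` only if both factors are nonzero, so
restricting to `q` loses nothing as long as `q` holds for those indices. Structure maps, inclusions,
projections and identifications of bases are all submatrices of `1`, so their composites reduce to
this. -/
theorem submatrixLin_comp [Finite I] [Fintype J] (p : L → Prop) (q : J → Prop) (r : I → Prop)
    (A : Matrix J L k) (B : Matrix I J k)
    (h : ∀ i j l, r i → p l → B i j ≠ 0 → A j l ≠ 0 → q j) :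
    submatrixLin q r B ∘ₗ submatrixLin p q A = submatrixLin p r (B * A) := by
  classical
  refine submatrixLin_hom_ext fun l i => ?_
  simp only [LinearMap.comp_apply, submatrixLin_single, Matrix.mul_apply]
  conv_lhs => rw [submatrixLin, Finsupp.linearCombination_apply, Finsupp.sum_fintype _ _ (by simp),
    Finsupp.finsetSum_apply]
  simp only [Finsupp.smul_apply, Finsupp.equivFunOnFinite_symm_apply_apply, smul_eq_mul,
    submatrixLin_single]
  have h1 : ∑ j : {j : J // q j}, A j.1 l.1 * B i.1 j.1 =
      ∑ j ∈ Finset.univ.filter (fun j => q j), A j l.1 * B i.1 j :=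
    (Finset.sum_subtype _ (by simp) (fun j => A j l.1 * B i.1 j)).symm
  rw [h1, Finset.sum_filter]
  refine Finset.sum_congr rfl fun j _ => ?_
  split_ifs with hj
  · exact mul_comm _ _
  · by_contra h0
    have h0' := Ne.symm h0
    exact hj (h i.1 j l.1 i.2 l.2 (left_ne_zero_of_mul h0') (right_ne_zero_of_mul h0'))

theorem eq_of_one_apply_ne_zero [DecidableEq I] {i j : I} (h : (1 : Matrix I I k) i j ≠ 0) :
    i = j :=
  by_contra fun h' => h (Matrix.one_apply_ne h')

theorem submatrixLin_zero [Finite I] (p : J → Prop) (q : I → Prop) :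
    submatrixLin p q (0 : Matrix I J k) = 0 :=
  submatrixLin_hom_ext fun j i => by simp

open Classical in
theorem submatrixLin_one_self [Fintype I] (p : I → Prop) :
    submatrixLin p p (1 : Matrix I I k) = LinearMap.id :=
  submatrixLin_hom_ext fun j i => by
    simp [Matrix.one_apply, Finsupp.single_apply, Subtype.ext_iff, eq_comm]

open Classical in
-- A submatrix of the identity restricts to the common indices and extends by zero.
theorem submatrixLin_one_apply [Fintype I] (p q : I → Prop) (x : {i : I // p i} →₀ k)
    (i : {i : I // q i}) :
    submatrixLin p q (1 : Matrix I I k) x i = if h : p i.1 then x ⟨i.1, h⟩ else 0 := by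
  induction x using Finsupp.induction_linear with
  | zero => simp
  | add f g hf hg => rw [map_add, Finsupp.add_apply, hf, hg]; split_ifs <;> simp
  | single a b =>
    rw [← mul_one b, ← smul_eq_mul, ← Finsupp.smul_single, map_smul, Finsupp.smul_apply,
      submatrixLin_single]
    split_ifs with h
    · simp [Matrix.one_apply, Finsupp.single_apply, Subtype.ext_iff, eq_comm]
    · have : i.1 ≠ a.1 := fun e => h (e ▸ a.2)
      simp [this]

open Classical in
theorem submatrixLin_comp_one_of_iff [Fintype I] [Fintype J] {p p' : J → Prop}
    (hp : ∀ j, p j ↔ p' j) {q q' : I → Prop} (hq : ∀ i, q i ↔ q' i) (A : Matrix I J k) :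
    submatrixLin p' q' A ∘ₗ submatrixLin p p' 1 = submatrixLin q q' 1 ∘ₗ submatrixLin p q A := by
  rw [submatrixLin_comp, submatrixLin_comp, Matrix.mul_one, Matrix.one_mul]
  · intro i j l hi _ h1 _
    obtain rfl := eq_of_one_apply_ne_zero h1
    exact (hq _).2 hi
  · intro i j l _ hl _ h2
    obtain rfl := eq_of_one_apply_ne_zero h2
    exact (hp _).1 hl

open Classical in
/-- The identification of the spaces of functions on equivalent predicates. -/
def submatrixEquiv [Fintype I] (p q : I → Prop) (h : ∀ i, p i ↔ q i) :
    ({i : I // p i} →₀ k) ≃ₗ[k] ({i : I // q i} →₀ k) :=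
  LinearEquiv.ofLinearMap (submatrixLin p q 1) (submatrixLin q p 1)
    (by rw [submatrixLin_comp _ _ _ _ _ fun i j l hi _ h1 _ =>
          (h _).2 (eq_of_one_apply_ne_zero h1 ▸ hi), one_mul, submatrixLin_one_self])
    (by rw [submatrixLin_comp _ _ _ _ _ fun i j l hi _ h1 _ =>
          (h _).1 (eq_of_one_apply_ne_zero h1 ▸ hi), one_mul, submatrixLin_one_self])

open Classical in
/-- The isomorphism with the dual space given by the dual basis. -/
def dualEquiv [Fintype I] (p q : I → Prop) (h : ∀ i, p i ↔ q i) :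
    ({i : I // p i} →₀ k) ≃ₗ[k] Module.Dual k ({i : I // q i} →₀ k) :=
  submatrixEquiv p q h ≪≫ₗ (Finsupp.basisSingleOne (R := k) (ι := {i : I // q i})).toDualEquiv

open Classical in
theorem dualEquiv_apply_single [Fintype I] (p q : I → Prop) (h : ∀ i, p i ↔ q i)
    (x : {i : I // p i} →₀ k) (j : {i : I // q i}) :
    dualEquiv p q h x (Finsupp.single j 1) = x ⟨j.1, (h _).2 j.2⟩ := by
  have e : (Finsupp.single j 1 : {i : I // q i} →₀ k) = Finsupp.basisSingleOne j := by simp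
  rw [e, dualEquiv, LinearEquiv.trans_apply, Module.Basis.toDualEquiv_apply,
    Module.Basis.toDual_apply_left, Finsupp.basisSingleOne_repr, LinearEquiv.refl_apply]
  change (submatrixLin p q 1 x) j = _
  rw [submatrixLin_one_apply, dif_pos]

/-- In dual bases the dual map has the transposed matrix. Two equivalent predicates are kept on each
side because one will be a condition on `z` and the other a condition on `-z`. -/
theorem dualEquiv_submatrixLin [Fintype I] [Fintype J] (p p' : J → Prop) (hp : ∀ j, p j ↔ p' j)
    (q q' : I → Prop) (hq : ∀ i, q i ↔ q' i) (A : Matrix I J k) :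
    (dualEquiv q q' hq).toLinearMap ∘ₗ submatrixLin p q A =
      (submatrixLin q' p' A.transpose).dualMap ∘ₗ (dualEquiv p p' hp).toLinearMap := by
  classical
  refine Finsupp.lhom_ext' fun j => LinearMap.ext_ring (Finsupp.lhom_ext' fun i =>
    LinearMap.ext_ring ?_)
  simp only [LinearMap.comp_apply, Finsupp.lsingle_apply, LinearEquiv.coe_coe,
    LinearMap.dualMap_apply, dualEquiv_apply_single, submatrixLin_single]
  have key : ∀ y : {j : J // p' j} →₀ k, dualEquiv p p' hp (Finsupp.single j 1) y =
      y ⟨j.1, (hp _).1 j.2⟩ := by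
    intro y
    induction y using Finsupp.induction_linear with
    | zero => simp
    | add f g hf hg => rw [map_add, hf, hg, Finsupp.add_apply]
    | single a b =>
      rw [← mul_one b, ← smul_eq_mul, ← Finsupp.smul_single, map_smul, dualEquiv_apply_single]
      simp [Finsupp.single_apply, Subtype.ext_iff, eq_comm]
  rw [key, submatrixLin_single, Matrix.transpose_apply]

end Submatrix

/-! ### Modules supported on convex sets -/

/-- Two relations between basis grades and grades are compatible if in all intervals that run from
the first one to the second one every point satisfies both. -/
structure Compatible {n : ℕ} (P Q : Grade n → Grade n → Prop) : Prop where
  mem : ∀ {g₁ g₂ g₃ z₁ z₂ z₃ : Grade n}, g₃ ≤ g₂ → g₂ ≤ g₁ → z₁ ≤ z₂ → z₂ ≤ z₃ →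
    P g₁ z₁ → Q g₃ z₃ → P g₂ z₂ ∧ Q g₂ z₂

/-- A rule that tells in which grades `z` a basis element of grade `g` is present. -/
structure Support (n : ℕ) where
  mem : Grade n → Grade n → Prop
  convex : Compatible mem mem

namespace Support

variable {k : Type u} [Field k] {n : ℕ} (P Q R : Support n) {I J L : Type v}

open Classical in
/-- The direct sum of the modules that are `k` in the grades `z` with `P.mem (g i) z` and `0`
elsewhere. -/
def module (k : Type u) [Field k] [Fintype I] (g : I → Grade n) : Pers.{u, v} k n where
  obj z := ModuleCat.of k ({i : I // P.mem (g i) z} →₀ k)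
  map {z w} _ := ModuleCat.ofHom (submatrixLin (fun i => P.mem (g i) z) (fun i => P.mem (g i) w) 1)
  map_id _ := congrArg ModuleCat.ofHom (submatrixLin_one_self _)
  map_comp {x y z} a b := congrArg ModuleCat.ofHom <| Eq.symm <| by
    -- By convexity, a basis element present at both `x` and `z` is present at the intermediate
    -- grade `y`.
    refine (submatrixLin_comp _ _ _ _ _ fun i j l hi hl h1 h2 => ?_).trans (by rw [one_mul])
    obtain rfl := eq_of_one_apply_ne_zero h1
    obtain rfl := eq_of_one_apply_ne_zero h2
    exact (P.convex.mem le_rfl le_rfl (leOfHom a) (leOfHom b) hl hi).1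

variable {P Q R}

open Classical in
-- Both composites are the submatrix of `A` from `P` at `z` to `Q` at `w`. In each, the middle basis
-- element lies in the interval between source and target, so compatibility ensures that it is
-- present.
theorem submatrixLin_naturality (h : Compatible P.mem Q.mem) [Fintype I] [Fintype J]
    {g' : I → Grade n} {g : J → Grade n} (A : Matrix I J k)
    (hA : ∀ i j, A i j ≠ 0 → g' i ≤ g j) {z w : Grade n} (hzw : z ≤ w) :
    submatrixLin (fun j => P.mem (g j) w) (fun i => Q.mem (g' i) w) A ∘ₗ
        submatrixLin (fun j => P.mem (g j) z) (fun j => P.mem (g j) w) 1 =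
      submatrixLin (fun i => Q.mem (g' i) z) (fun i => Q.mem (g' i) w) 1 ∘ₗ
        submatrixLin (fun j => P.mem (g j) z) (fun i => Q.mem (g' i) z) A := by
  rw [submatrixLin_comp, submatrixLin_comp, Matrix.mul_one, Matrix.one_mul]
  · intro i j l hi hl h1 h2
    obtain rfl := eq_of_one_apply_ne_zero h1
    exact (h.mem le_rfl (hA _ _ h2) le_rfl hzw hl hi).2
  · intro i j l hi hl h1 h2
    obtain rfl := eq_of_one_apply_ne_zero h2
    exact (h.mem (hA _ _ h1) le_rfl hzw le_rfl hl hi).1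

/-- The morphism represented by a matrix. -/
def matHom (h : Compatible P.mem Q.mem) [Fintype I] [Fintype J] {g' : I → Grade n}
    {g : J → Grade n} (A : Matrix I J k) (hA : ∀ i j, A i j ≠ 0 → g' i ≤ g j) :
    P.module k g ⟶ Q.module k g' where
  app z := ModuleCat.ofHom (submatrixLin (fun j => P.mem (g j) z) (fun i => Q.mem (g' i) z) A)
  naturality _ _ f := congrArg ModuleCat.ofHom (submatrixLin_naturality h A hA (leOfHom f))

theorem matHom_comp (hPQ : Compatible P.mem Q.mem) (hQR : Compatible Q.mem R.mem)
    (hPR : Compatible P.mem R.mem)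
    (h : ∀ {g₁ g₂ g₃ z}, g₃ ≤ g₂ → g₂ ≤ g₁ → P.mem g₁ z → R.mem g₃ z → Q.mem g₂ z)
    [Fintype I] [Fintype J] [Fintype L] {g₃ : I → Grade n} {g₂ : J → Grade n} {g₁ : L → Grade n}
    (A : Matrix J L k) (hA : ∀ i j, A i j ≠ 0 → g₂ i ≤ g₁ j)
    (B : Matrix I J k) (hB : ∀ i j, B i j ≠ 0 → g₃ i ≤ g₂ j)
    (C : Matrix I L k) (hC : ∀ i j, C i j ≠ 0 → g₃ i ≤ g₁ j) (e : B * A = C) :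
    matHom hPQ A hA ≫ matHom hQR B hB = matHom hPR C hC := by
  subst e
  exact NatTrans.ext (funext fun z => congrArg ModuleCat.ofHom
    (submatrixLin_comp _ _ _ A B fun i j l hi hl h1 h2 => h (hB _ _ h1) (hA _ _ h2) hl hi))

theorem matHom_zero (h : Compatible P.mem Q.mem) [Fintype I] [Fintype J] {g' : I → Grade n}
    {g : J → Grade n} (A : Matrix I J k) (hA : ∀ i j, A i j ≠ 0 → g' i ≤ g j) (h0 : A = 0) :
    matHom h A hA = 0 := by
  subst h0
  exact NatTrans.ext (funext fun z => congrArg ModuleCat.ofHom (submatrixLin_zero _ _))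

theorem matrix_mul_grade [Fintype J] {g₃ : I → Grade n} {g₂ : J → Grade n} {g₁ : L → Grade n}
    {A : Matrix J L k} (hA : ∀ i j, A i j ≠ 0 → g₂ i ≤ g₁ j)
    {B : Matrix I J k} (hB : ∀ i j, B i j ≠ 0 → g₃ i ≤ g₂ j) (i : I) (l : L)
    (h : (B * A) i l ≠ 0) : g₃ i ≤ g₁ l := by
  rw [Matrix.mul_apply] at h
  obtain ⟨j, -, h⟩ := Finset.exists_ne_zero_of_sum_ne_zero h
  exact (hB _ _ (left_ne_zero_of_mul h)).trans (hA _ _ (right_ne_zero_of_mul h))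

variable (k) (P)

/-- The complex with the basis elements and the boundary matrices of `C_•(K_*)` whose basis
elements are present as prescribed by `P`. -/
def complex (K : Filtration.{v} n) : ChainComplex (Pers.{u, v} k n) ℤ where
  X d := P.module k (K.grade (d := d))
  d i j := matHom P.convex (K.bd k i j) (K.bd_grade k)
  shape _ _ h := matHom_zero _ _ _ (K.bd_shape k h)
  d_comp_d' i j l _ _ := by
    rw [matHom_comp P.convex P.convex P.convex
      (fun h h' hl hi => (P.convex.mem h h' le_rfl le_rfl hl hi).1) _ _ _ _ 0
      (fun _ _ h0 => absurd rfl h0) (K.bd_mul_bd k i j l)]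
    exact matHom_zero _ _ _ rfl

variable {k}

/-- The map induced by a chain map. -/
def complexMap {K L : Filtration.{v} n} (φ : ChainMap k K L) : P.complex k K ⟶ P.complex k L where
  f d := matHom P.convex (φ.mat d) φ.graded
  comm' i j _ := by
    refine (matHom_comp P.convex P.convex P.convex
      (fun h h' hl hi => (P.convex.mem h h' le_rfl le_rfl hl hi).1) _ _ _ (L.bd_grade k) _
      (matrix_mul_grade φ.graded (L.bd_grade k)) rfl).trans
      (matHom_comp P.convex P.convex P.convex
        (fun h h' hl hi => (P.convex.mem h h' le_rfl le_rfl hl hi).1) _ (K.bd_grade k) _ _ _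
        _ (φ.comm i j).symm).symm

variable {P}

open Classical in
theorem grade_le_of_one_apply_ne_zero (g : I → Grade n) (i j : I)
    (h : (1 : Matrix I I k) i j ≠ 0) : g i ≤ g j :=
  (congrArg g (eq_of_one_apply_ne_zero h)).le

open Classical in
-- With its mirror image below, this makes changing the support commute with every graded matrix:
-- with boundaries, which gives a chain map, and with chain maps, which gives naturality.
theorem matHom_one_comp (h : Compatible P.mem Q.mem) [Fintype I] [Fintype J] {g' : I → Grade n}
    {g : J → Grade n} (A : Matrix I J k) (hA : ∀ i j, A i j ≠ 0 → g' i ≤ g j) :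
    matHom h 1 (grade_le_of_one_apply_ne_zero g) ≫ matHom Q.convex A hA = matHom h A hA :=
  matHom_comp h Q.convex h (fun h1 h2 hl hi => (h.mem h1 h2 le_rfl le_rfl hl hi).2) _ _ _ _ _ _
    (Matrix.mul_one A)

open Classical in
theorem matHom_comp_one (h : Compatible P.mem Q.mem) [Fintype I] [Fintype J] {g' : I → Grade n}
    {g : J → Grade n} (A : Matrix I J k) (hA : ∀ i j, A i j ≠ 0 → g' i ≤ g j) :
    matHom P.convex A hA ≫ matHom h 1 (grade_le_of_one_apply_ne_zero g') = matHom h A hA :=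
  matHom_comp P.convex h h (fun h1 h2 hl hi => (h.mem h1 h2 le_rfl le_rfl hl hi).1) _ _ _ _ _ _
    (Matrix.one_mul A)

variable (k)

open Classical in
/-- The canonical map between the complexes of compatible supports. -/
def change (h : Compatible P.mem Q.mem) (K : Filtration.{v} n) :
    P.complex k K ⟶ Q.complex k K where
  f _ := matHom h 1 (grade_le_of_one_apply_ne_zero _)
  comm' i j _ := (matHom_one_comp h (K.bd k i j) (K.bd_grade k)).trans
    (matHom_comp_one h (K.bd k i j) (K.bd_grade k)).symm

variable {k}

theorem change_naturality (h : Compatible P.mem Q.mem) {K L : Filtration.{v} n}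
    (φ : ChainMap k K L) :
    P.complexMap φ ≫ change k h L = change k h K ≫ Q.complexMap φ :=
  HomologicalComplex.hom_ext _ _ fun d =>
    (matHom_comp_one h (φ.mat d) φ.graded).trans (matHom_one_comp h (φ.mat d) φ.graded).symm

end Support

/-! ### Exactness and homology of complexes of persistence modules, grade by grade -/

section Pointwise

variable {k : Type u} [Field k] {n : ℕ}

/-- Evaluation in a grade. -/
abbrev evalAt (k : Type u) [Field k] {n : ℕ} (z : Grade n) :
    Pers.{u, v} k n ⥤ ModuleCat.{max u v} k :=
  (evaluation (Grade n) (ModuleCat.{max u v} k)).obj z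

/-- Homology is computed grade by grade. -/
def homologyObjIso {ι : Type} {c : ComplexShape ι} (C : HomologicalComplex (Pers.{u, v} k n) c)
    (d : ι) (z : Grade n) :
    (((evalAt k z).mapHomologicalComplex c).obj C).homology d ≅ (C.homology d).obj z :=
  (C.sc d).mapHomologyIso (evalAt k z)

theorem isZero_of_obj (M : Pers.{u, v} k n) (h : ∀ z, Limits.IsZero (M.obj z)) :
    Limits.IsZero M :=
  Functor.isZero _ h

theorem exact_of_eval (S : ShortComplex (Pers.{u, v} k n))
    (h : ∀ z, (S.map (evalAt k z)).Exact) : S.Exact := by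
  rw [ShortComplex.exact_iff_isZero_homology]
  exact isZero_of_obj _ fun z => Limits.IsZero.of_iso
    ((ShortComplex.exact_iff_isZero_homology _).1 (h z)) (S.mapHomologyIso (evalAt k z)).symm

theorem shortExact_of_eval (S : ShortComplex (Pers.{u, v} k n))
    (h : ∀ z, (S.map (evalAt k z)).ShortExact) : S.ShortExact where
  exact := exact_of_eval S fun z => (h z).exact
  mono_f := by
    have : ∀ z, Mono (S.f.app z) := fun z => (h z).mono_f
    exact NatTrans.mono_of_mono_app _
  epi_g := by
    have : ∀ z, Epi (S.g.app z) := fun z => (h z).epi_g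
    exact NatTrans.epi_of_epi_app _

end Pointwise

/-! ### The supports that interpolate between the chains and the dual of the cochains -/

namespace Support

/-! ### Short exact sequences obtained by splitting a support in two -/

section Sequence

variable {k : Type u} [Field k] {n : ℕ} {P Q R : Support n}

/-- `Q` is the union of the disjoint supports `P` and `R`, where `P` is closed under structure
maps in `Q`. -/
structure IsExtension (P Q R : Support n) : Prop where
  left : Compatible P.mem Q.mem
  right : Compatible Q.mem R.mem
  disjoint : ∀ g z, P.mem g z → ¬ R.mem g z
  mem_iff : ∀ g z, Q.mem g z ↔ P.mem g z ∨ R.mem g z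

theorem change_comp_change (h : IsExtension P Q R) (K : Filtration.{v} n) :
    change k h.left K ≫ change k h.right K = 0 := by
  classical
  refine HomologicalComplex.hom_ext _ _ fun d => NatTrans.ext (funext fun z => ?_)
  refine congrArg ModuleCat.ofHom (?_ : submatrixLin (fun σ => Q.mem (K.grade σ) z)
    (fun σ => R.mem (K.grade σ) z) 1 ∘ₗ submatrixLin (fun σ => P.mem (K.grade σ) z)
    (fun σ => Q.mem (K.grade σ) z) 1 = 0)
  refine LinearMap.ext fun x => Finsupp.ext fun i => ?_
  rw [LinearMap.comp_apply, submatrixLin_one_apply, dif_pos ((h.mem_iff _ _).2 (Or.inr i.2)),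
    submatrixLin_one_apply, dif_neg fun h' => h.disjoint _ _ h' i.2]
  rfl

variable (k) in
/-- The sequence of complexes of an extension of supports. -/
def sequence (h : IsExtension P Q R) (K : Filtration.{v} n) :
    ShortComplex (ChainComplex (Pers.{u, v} k n) ℤ) :=
  ShortComplex.mk _ _ (change_comp_change (k := k) h K)

/-- In a fixed degree and grade, the basis for `Q` is the disjoint union of those for `P` and `R`,
and the two maps are coordinate inclusion and projection. -/
theorem sequence_shortExact (h : IsExtension P Q R) (K : Filtration.{v} n) :
    (sequence k h K).ShortExact := by
  classical
  refine HomologicalComplex.shortExact_of_degreewise_shortExact _ fun d =>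
    shortExact_of_eval _ fun z => ?_
  refine ModuleCat.shortComplex_shortExact _ ?_ ?_ ?_
  · change Function.Exact (submatrixLin (k := k) (fun σ : K.Simp d => P.mem (K.grade σ) z)
      (fun σ => Q.mem (K.grade σ) z) 1) (submatrixLin (fun σ : K.Simp d => Q.mem (K.grade σ) z)
      (fun σ => R.mem (K.grade σ) z) 1)
    intro x
    constructor
    · intro hx
      -- The preimage is the restriction of `x` to `P`; the remaining coordinates belong to `R`,
      -- where `hx` makes `x` vanish.
      refine ⟨submatrixLin _ _ 1 x, Finsupp.ext fun i => ?_⟩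
      rw [submatrixLin_one_apply]
      split_ifs with hi
      · rw [submatrixLin_one_apply, dif_pos i.2]
      · have hR := ((h.mem_iff _ _).1 i.2).resolve_left hi
        have := DFunLike.congr_fun hx ⟨i.1, hR⟩
        rw [submatrixLin_one_apply, dif_pos i.2] at this
        exact this.symm
    · rintro ⟨y, rfl⟩
      refine Finsupp.ext fun i => ?_
      rw [submatrixLin_one_apply, dif_pos ((h.mem_iff _ _).2 (Or.inr i.2)),
        submatrixLin_one_apply, dif_neg fun h' => h.disjoint _ _ h' i.2]
      rfl
  · change Function.Injective (submatrixLin (k := k) (fun σ : K.Simp d => P.mem (K.grade σ) z)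
      (fun σ => Q.mem (K.grade σ) z) 1)
    intro x y hxy
    refine Finsupp.ext fun i => ?_
    have := DFunLike.congr_fun hxy ⟨i.1, (h.mem_iff _ _).2 (Or.inl i.2)⟩
    rwa [submatrixLin_one_apply, submatrixLin_one_apply, dif_pos i.2, dif_pos i.2] at this
  · change Function.Surjective (submatrixLin (k := k) (fun σ : K.Simp d => Q.mem (K.grade σ) z)
      (fun σ => R.mem (K.grade σ) z) 1)
    intro y
    refine ⟨submatrixLin _ _ 1 y, Finsupp.ext fun i => ?_⟩
    rw [submatrixLin_one_apply, dif_pos ((h.mem_iff _ _).2 (Or.inr i.2)), submatrixLin_one_apply,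
      dif_pos i.2]

/-- The map of short exact sequences induced by a chain map. -/
def sequenceMap (h : IsExtension P Q R) {K L : Filtration.{v} n} (φ : ChainMap k K L) :
    sequence k h K ⟶ sequence k h L where
  τ₁ := P.complexMap φ
  τ₂ := Q.complexMap φ
  τ₃ := R.complexMap φ
  comm₁₂ := change_naturality h.left φ
  comm₂₃ := change_naturality h.right φ

open Classical in
/-- In a fixed grade the complex depends only on the set of simplices present in it. -/
def evalComplexIso (P Q : Support n) (K : Filtration.{v} n) (z w : Grade n)
    (h : ∀ {d : ℤ} (σ : K.Simp d), P.mem (K.grade σ) z ↔ Q.mem (K.grade σ) w) :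
    ((evalAt k z).mapHomologicalComplex _).obj (P.complex k K) ≅
      ((evalAt k w).mapHomologicalComplex _).obj (Q.complex k K) :=
  HomologicalComplex.Hom.isoOfComponents
    (fun d => (submatrixEquiv (k := k) (fun σ : K.Simp d => P.mem (K.grade σ) z)
      (fun σ : K.Simp d => Q.mem (K.grade σ) w) h).toModuleIso)
    fun i j _ => ModuleCat.hom_ext (submatrixLin_comp_one_of_iff h h (K.bd k i j))

end Sequence

/-! ### Orthants and slabs -/

/-- The support `z i < g i` for `i < m` and `g i ≤ z i` for `i ≥ m`. -/
def orthant (n m : ℕ) : Support n where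
  mem g z := ∀ i : Fin n, (i.1 < m → z i < g i) ∧ (m ≤ i.1 → g i ≤ z i)
  convex := ⟨fun {g₁ g₂ g₃ z₁ z₂ z₃} hg hg' hz hz' h₁ h₃ => by
    have key : ∀ i : Fin n, (i.1 < m → z₂ i < g₂ i) ∧ (m ≤ i.1 → g₂ i ≤ z₂ i) := fun i =>
      ⟨fun hi => ((hz' i).trans_lt ((h₃ i).1 hi)).trans_le (hg i),
        fun hi => ((hg' i).trans ((h₁ i).2 hi)).trans (hz i)⟩
    exact ⟨key, key⟩⟩

/-- The support `z i < g i` for `i < m` and `g i ≤ z i` for `i > m`. -/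
def slab (n m : ℕ) : Support n where
  mem g z := ∀ i : Fin n, (i.1 < m → z i < g i) ∧ (m < i.1 → g i ≤ z i)
  convex := ⟨fun {g₁ g₂ g₃ z₁ z₂ z₃} hg hg' hz hz' h₁ h₃ => by
    have key : ∀ i : Fin n, (i.1 < m → z₂ i < g₂ i) ∧ (m < i.1 → g₂ i ≤ z₂ i) := fun i =>
      ⟨fun hi => ((hz' i).trans_lt ((h₃ i).1 hi)).trans_le (hg i),
        fun hi => ((hg' i).trans ((h₁ i).2 hi)).trans (hz i)⟩
    exact ⟨key, key⟩⟩

/-- Coordinate `m` decides between the two orthants. The one with `g m ≤ z m` is the subobject,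
since this inequality survives raising `z` and lowering `g`. -/
theorem isExtension_slab {n m : ℕ} (hm : m < n) :
    IsExtension (orthant n m) (slab n m) (orthant n (m + 1)) where
  left := ⟨fun {g₁ g₂ g₃ z₁ z₂ z₃} hg hg' hz hz' h₁ h₃ => by
    have key : (orthant n m).mem g₂ z₂ := fun i =>
      ⟨fun hi => ((hz' i).trans_lt ((h₃ i).1 hi)).trans_le (hg i),
        fun hi => ((hg' i).trans ((h₁ i).2 hi)).trans (hz i)⟩
    exact ⟨key, fun i => ⟨(key i).1, fun hi => (key i).2 hi.le⟩⟩⟩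
  right := ⟨fun {g₁ g₂ g₃ z₁ z₂ z₃} hg hg' hz hz' h₁ h₃ => by
    have key : (orthant n (m + 1)).mem g₂ z₂ := fun i =>
      ⟨fun hi => ((hz' i).trans_lt ((h₃ i).1 hi)).trans_le (hg i),
        fun hi => ((hg' i).trans ((h₁ i).2 hi)).trans (hz i)⟩
    exact ⟨fun i => ⟨fun hi => (key i).1 (by omega), (key i).2⟩, key⟩⟩
  disjoint g z h h' := absurd ((h ⟨m, hm⟩).2 le_rfl) ((h' ⟨m, hm⟩).1 (Nat.lt_succ_self m)).not_ge
  mem_iff g z := by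
    constructor
    · intro h
      rcases le_or_gt (g ⟨m, hm⟩) (z ⟨m, hm⟩) with h0 | h0
      · refine Or.inl fun i => ⟨(h i).1, fun hi => ?_⟩
        rcases hi.eq_or_lt with hi | hi
        · obtain rfl : (⟨m, hm⟩ : Fin n) = i := Fin.ext hi
          exact h0
        · exact (h i).2 hi
      · refine Or.inr fun i => ⟨fun hi => ?_, (h i).2⟩
        rcases (Nat.lt_succ_iff.1 hi).eq_or_lt with hi | hi
        · obtain rfl : (⟨m, hm⟩ : Fin n) = i := Fin.ext hi.symm
          exact h0
        · exact (h i).1 hi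
    · rintro (h | h)
      · exact fun i => ⟨(h i).1, fun hi => (h i).2 hi.le⟩
      · exact fun i => ⟨fun hi => (h i).1 (by omega), (h i).2⟩

/-- `{z | M_z ≠ 0}` is finite. -/
def _root_.MultiPers.FiniteSupport {k : Type u} [Field k] {n : ℕ} (M : Pers.{u, v} k n) : Prop :=
  {z | Nontrivial (M.obj z)}.Finite

theorem _root_.MultiPers.FiniteSupport.of_iso {k : Type u} [Field k] {n : ℕ}
    {M N : Pers.{u, v} k n} (h : FiniteSupport M) (e : M ≅ N) : FiniteSupport N :=
  h.subset fun z hz => by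
    have : Nontrivial (N.obj z) := hz
    exact (e.app z).toLinearEquiv.toEquiv.nontrivial

/-! ### Vanishing of the homology of slabs -/

section Vanishing

variable {k : Type u} [Field k] {n : ℕ} (K : Filtration.{v} n)

theorem exists_grade_le (i : Fin n) : ∃ c : ℤ, ∀ {d : ℤ} (σ : K.Simp d), K.grade σ i ≤ c := by
  have hfin : {x : ℤ | ∃ (d : ℤ) (σ : K.Simp d), K.grade σ i = x}.Finite := by
    have := K.finite.to_subtype
    let f : (⋃ z, K.cx z : Set (Finset K.V)) → ℤ := fun σ =>
      -- The dimension is recovered from the cardinality, so the finite set of all simplices bounds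
      -- every degree at once.
      K.grade (d := (σ.1.card : ℤ) - 1) ⟨σ.1, σ.2, by omega⟩ i
    refine (Set.finite_range f).subset ?_
    rintro x ⟨d, σ, rfl⟩
    exact ⟨⟨σ.val, σ.mem⟩, rfl⟩
  obtain ⟨c, hc⟩ := hfin.bddAbove
  exact ⟨c, fun {d} σ => hc ⟨d, σ, rfl⟩⟩

/-- The grade `z` with its coordinate `i` replaced by `c`. -/
def _root_.MultiPers.Grade.replace (z : Grade n) (i : Fin n) (c : ℤ) : Grade n :=
  fun j => if j = i then c else z j

theorem _root_.MultiPers.Grade.replace_self (z : Grade n) (i : Fin n) (c : ℤ) :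
    z.replace i c i = c :=
  if_pos rfl

theorem _root_.MultiPers.Grade.replace_of_ne (z : Grade n) {i j : Fin n} (c : ℤ) (h : j ≠ i) :
    z.replace i c j = z j :=
  if_neg h

/-- The slab ignores coordinate `m`, and at `c` the orthant's condition on that coordinate holds
automatically. -/
theorem slab_mem_iff {m : ℕ} (hm : m < n) {g z : Grade n} {c : ℤ} (hc : g ⟨m, hm⟩ ≤ c) :
    (slab n m).mem g z ↔
      (orthant n m).mem g (z.replace ⟨m, hm⟩ c) := by
  refine forall_congr' fun i => ?_
  by_cases hi : i = ⟨m, hm⟩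
  · subst hi
    simp [hc, Grade.replace_self]
  · have h1 : i.1 ≠ m := fun h => hi (Fin.ext h)
    rw [Grade.replace_of_ne z c hi]
    refine and_congr Iff.rfl ?_
    exact ⟨fun h h' => h (lt_of_le_of_ne h' h1.symm), fun h h' => h h'.le⟩

/-- The slab homology at `z` equals the orthant homology at each of the infinitely many grades `u
t`, and finite support forces the latter to vanish at one of them. -/
theorem isZero_homology_slab {m : ℕ} (hm : m < n) (e : ℤ)
    (h : FiniteSupport (((orthant n m).complex k K).homology e)) :
    Limits.IsZero (((slab n m).complex k K).homology e) := by
  refine isZero_of_obj _ fun z => ?_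
  obtain ⟨c, hc⟩ := exists_grade_le K ⟨m, hm⟩
  let u : ℕ → Grade n := fun t =>
    z.replace ⟨m, hm⟩ (c + t)
  have hu : Function.Injective u := fun s t hst => by
    have := congrFun (α := Fin n) (β := fun _ => ℤ) hst ⟨m, hm⟩
    simpa [u, Grade.replace_self] using this
  obtain ⟨t, ht⟩ := (h.preimage hu.injOn).exists_notMem
  have h0 : Limits.IsZero ((((orthant n m).complex k K).homology e).obj (u t)) := by
    rw [ModuleCat.isZero_iff_subsingleton]
    exact not_nontrivial_iff_subsingleton.1 ht
  refine h0.of_iso ((homologyObjIso _ _ _).symm ≪≫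
    (HomologicalComplex.homologyFunctor _ _ e).mapIso
      (evalComplexIso (slab n m) (orthant n m) K z (u t) fun σ => ?_) ≪≫ homologyObjIso _ _ _)
  exact slab_mem_iff hm ((hc σ).trans (by simp))

end Vanishing

end Support

/-! ### The chain complex as a complex with prescribed supports -/

section Chains

variable {k : Type u} [Field k] {n : ℕ}

open Classical in
theorem sumStruct_eq {I : Type v} [Fintype I] (U : I → UpperSet (Grade n)) {z w : Grade n}
    (h : z ≤ w) :
    sumStruct k U h = submatrixLin (fun i => z ∈ U i) (fun i => w ∈ U i) 1 :=
  submatrixLin_hom_ext fun j i => by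
    rw [submatrixLin_single, sumStruct, Finsupp.lmapDomain_apply, Finsupp.mapDomain_single]
    simp [Matrix.one_apply, Finsupp.single_apply, Subtype.ext_iff, eq_comm]

/-- One-criticality enters here through `presence_eq`: presence is determined by the grade alone. -/
theorem mem_presence_iff (K : Filtration.{v} n) {d : ℤ} (σ : K.Simp d) (z : Grade n) :
    z ∈ K.presence σ ↔ (Support.orthant n 0).mem (K.grade σ) z := by
  rw [K.presence_eq, UpperSet.mem_Ici_iff]
  exact ⟨fun h i => ⟨fun hi => absurd hi (Nat.not_lt_zero _), fun _ => h i⟩,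
    fun h i => (h i).2 (Nat.zero_le _)⟩

/-- The shift by `ε` turns the strict integer inequality `z i < g i` into `-g i + 1 ≤ -z i`. -/
theorem neg_mem_coGrade_iff (K : Filtration.{v} n) {d : ℤ} (σ : K.Simp d) (z : Grade n) :
    (Support.orthant n n).mem (K.grade σ) z ↔ -z ∈ UpperSet.Ici (K.coGrade σ) := by
  rw [UpperSet.mem_Ici_iff]
  have h0 : K.coGrade σ ≤ -z ↔ ∀ i : Fin n, -(K.grade σ i) + 1 ≤ -(z i) := Iff.rfl
  rw [h0]
  refine forall_congr' fun i => ?_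
  have := i.2
  constructor
  · intro h
    have := h.1 i.2
    omega
  · intro h
    exact ⟨fun _ => by omega, fun hi => by omega⟩

open Classical in
/-- The simplicial chain modules as modules with prescribed supports. -/
def chainsXIso (K : Filtration.{v} n) (d : ℤ) :
    (K.chains k).X d ≅ ((Support.orthant n 0).complex k K).X d :=
  NatIso.ofComponents
    (fun z => (submatrixEquiv (k := k) (fun σ : K.Simp d => z ∈ K.presence σ)
      (fun σ : K.Simp d => (Support.orthant n 0).mem (K.grade σ) z)
      fun σ => mem_presence_iff K σ z).toModuleIso)
    fun {z w} f => ModuleCat.hom_ext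
      ((congrArg _ (sumStruct_eq (k := k) (K.presence (d := d)) (leOfHom f))).trans
        (submatrixLin_comp_one_of_iff (k := k)
          (fun σ => mem_presence_iff K σ z) (fun σ => mem_presence_iff K σ w) 1).symm)

/-- The simplicial chain complex as a complex with prescribed supports. -/
def chainsIso (k : Type u) [Field k] (K : Filtration.{v} n) :
    K.chains k ≅ (Support.orthant n 0).complex k K :=
  HomologicalComplex.Hom.isoOfComponents (fun d => chainsXIso K d) fun i j _ =>
    NatTrans.ext (funext fun z => ModuleCat.hom_ext (submatrixLin_comp_one_of_iff (k := k)
      (fun σ => mem_presence_iff K σ z) (fun σ => mem_presence_iff K σ z) (K.bd k i j)))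

theorem chainsIso_naturality {K L : Filtration.{v} n} (φ : ChainMap k K L) :
    φ.onChains ≫ (chainsIso k L).hom =
      (chainsIso k K).hom ≫ (Support.orthant n 0).complexMap φ :=
  HomologicalComplex.hom_ext _ _ fun d =>
    NatTrans.ext (funext fun z => ModuleCat.hom_ext (submatrixLin_comp_one_of_iff (k := k)
      (fun σ => mem_presence_iff K σ z) (fun σ => mem_presence_iff L σ z) (φ.mat d)).symm)

end Chains

/-! ### Duality is exact -/

section Dual

variable {k : Type u} [Field k] {n : ℕ}

/-- Duality as a functor. -/
def dualFunctor (k : Type u) [Field k] (n : ℕ) : (Pers.{u, v} k n)ᵒᵖ ⥤ Pers.{u, v} k n where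
  obj M := dual M.unop
  map f := dualMap f.unop
  map_id _ := rfl
  map_comp _ _ := rfl

instance : (dualFunctor.{u, v} k n).PreservesZeroMorphisms where
  map_zero M _ := NatTrans.ext (funext fun z => ModuleCat.hom_ext
    (LinearMap.ext fun φ => LinearMap.ext fun _ =>
      map_zero (show Module.Dual k (M.unop.obj (-z)) from φ)))

/-- Over a field functionals extend from subspaces, so the range of `g.dualMap` is the full
annihilator of `ker g`, which is also the annihilator of `range f`. -/
theorem dualMap_exact {M₁ M₂ M₃ : Type*} [AddCommGroup M₁] [AddCommGroup M₂] [AddCommGroup M₃]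
    [Module k M₁] [Module k M₂] [Module k M₃] (f : M₁ →ₗ[k] M₂) (g : M₂ →ₗ[k] M₃)
    (h : LinearMap.range f = LinearMap.ker g) : Function.Exact g.dualMap f.dualMap := by
  rw [LinearMap.exact_iff, LinearMap.range_dualMap_eq_dualAnnihilator_ker,
    LinearMap.ker_dualMap_eq_dualAnnihilator_range, h]

instance : (dualFunctor.{u, v} k n).PreservesHomology := by
  refine Functor.preservesHomology_of_map_exact _ fun S hS => exact_of_eval _ fun z => ?_
  refine ModuleCat.shortComplex_exact _ ?_
  have h := (hS.unop.map (evalAt k (-z))).moduleCat_range_eq_ker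
  exact dualMap_exact _ _ h

theorem comm_sq_paste {C : Type*} [Category* C] {X₁ X₂ X₃ Y₁ Y₂ Y₃ : C} {a : X₁ ⟶ Y₁}
    {b : X₂ ⟶ Y₂} {c : X₃ ⟶ Y₃} {f : X₁ ⟶ X₂} {f' : X₂ ⟶ X₃} {g : Y₁ ⟶ Y₂} {g' : Y₂ ⟶ Y₃}
    (h : a ≫ g = f ≫ b) (h' : b ≫ g' = f' ≫ c) : a ≫ g ≫ g' = (f ≫ f') ≫ c := by
  rw [Category.assoc, ← h', reassoc_of% h]

/-- The homology of the dual complex is the dual of the homology. -/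
def dualHomologyIso {ι : Type} {c : ComplexShape ι} (C : HomologicalComplex (Pers.{u, v} k n) c)
    (d : ι) :
    (((dualFunctor k n).mapHomologicalComplex _).obj C.op).homology d ≅ dual (C.homology d) :=
  (C.op.sc d).mapHomologyIso (dualFunctor k n) ≪≫ (dualFunctor k n).mapIso (C.homologyOp d)

theorem dualHomologyIso_naturality {ι : Type} {c : ComplexShape ι}
    {C D : HomologicalComplex (Pers.{u, v} k n) c} (f : C ⟶ D) (d : ι) :
    HomologicalComplex.homologyMap (((dualFunctor k n).mapHomologicalComplex _).map
        ((HomologicalComplex.opFunctor _ _).map f.op)) d ≫ (dualHomologyIso C d).hom =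
      (dualHomologyIso D d).hom ≫ dualMap (HomologicalComplex.homologyMap f d) := by
  have h1 := ShortComplex.mapHomologyIso_hom_naturality (F := dualFunctor k n)
    ((HomologicalComplex.shortComplexFunctor _ _ d).map
      ((HomologicalComplex.opFunctor _ _).map f.op))
  have h2 := ((dualFunctor k n).map_comp _ _).symm.trans <|
    (congrArg (dualFunctor k n).map (HomologicalComplex.homologyOp_hom_naturality f d)).trans
      ((dualFunctor k n).map_comp _ _)
  exact comm_sq_paste h1 h2

/-- The complex of the negative orthant in each degree is dual to the cochains. -/
def dualXIso (K : Filtration.{v} n) (d : ℤ) :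
    ((Support.orthant n n).complex k K).X d ≅ dual ((K.N k).X d) :=
  NatIso.ofComponents
    (fun z => (dualEquiv (k := k)
      (fun σ : K.Simp d => (Support.orthant n n).mem (K.grade σ) z)
      (fun σ : K.Simp d => -z ∈ UpperSet.Ici (K.coGrade σ))
      fun σ => neg_mem_coGrade_iff K σ z).toModuleIso)
    fun {z w} f => ModuleCat.hom_ext <| by
      classical
      have h := dualEquiv_submatrixLin (k := k) _ _ (fun σ => neg_mem_coGrade_iff K (d := d) σ z)
        _ _ (fun σ => neg_mem_coGrade_iff K (d := d) σ w) 1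
      rw [Matrix.transpose_one, ← sumStruct_eq (k := k) (fun σ => UpperSet.Ici (K.coGrade σ))
        (neg_le_neg (leOfHom f))] at h
      exact h

/-- The complex of the negative orthant is dual to the cochain complex. -/
def dualComplexIso (k : Type u) [Field k] (K : Filtration.{v} n) :
    (Support.orthant n n).complex k K ≅
      (show ChainComplex (Pers.{u, v} k n) ℤ from
        ((dualFunctor k n).mapHomologicalComplex _).obj (K.N k).op) :=
  HomologicalComplex.Hom.isoOfComponents (fun d => dualXIso K d) fun i j _ =>
    NatTrans.ext (funext fun z => ModuleCat.hom_ext (dualEquiv_submatrixLin (k := k) _ _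
      (fun σ => neg_mem_coGrade_iff K σ z) _ _ (fun σ => neg_mem_coGrade_iff K σ z)
      (K.bd k i j)).symm)

theorem dualComplexIso_naturality {K L : Filtration.{v} n} (φ : ChainMap k K L) :
    (Support.orthant n n).complexMap φ ≫ (dualComplexIso k L).hom =
      (dualComplexIso k K).hom ≫ (show (show ChainComplex (Pers.{u, v} k n) ℤ from
        ((dualFunctor k n).mapHomologicalComplex _).obj (K.N k).op) ⟶
          (show ChainComplex (Pers.{u, v} k n) ℤ from
        ((dualFunctor k n).mapHomologicalComplex _).obj (L.N k).op) from
        ((dualFunctor k n).mapHomologicalComplex _).map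
        ((HomologicalComplex.opFunctor _ _).map φ.onN.op)) :=
  HomologicalComplex.hom_ext _ _ fun d =>
    NatTrans.ext (funext fun z => ModuleCat.hom_ext (dualEquiv_submatrixLin (k := k) _ _
      (fun σ => neg_mem_coGrade_iff K σ z) _ _ (fun σ => neg_mem_coGrade_iff L σ z)
      (φ.mat d)))

end Dual

/-! ### The iterated connecting homomorphism -/

section Connecting

variable {k : Type u} [Field k] {n : ℕ}

/-- The composite `H_i(orthant m) ⟶ H_{i-1}(orthant (m-1)) ⟶ ⋯ ⟶ H_j(orthant 0)` of connecting
homomorphisms, where `i = j + m`. -/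
def connecting (k : Type u) [Field k] (K : Filtration.{v} n) : (m : ℕ) → m ≤ n → (i j : ℤ) →
    i = j + m → (((Support.orthant n m).complex k K).homology i ⟶
      ((Support.orthant n 0).complex k K).homology j)
  -- The degrees `i` and `j` are separate variables linked by `h`, so only this base case has to
  -- transport along an equality of degrees.
  | 0, _, i, j, h => eqToHom (by rw [h, Nat.cast_zero, add_zero])
  | m + 1, hm, i, j, h =>
      (Support.sequence_shortExact (k := k) (Support.isExtension_slab hm) K).δ i (i - 1)
        (sub_add_cancel i 1) ≫
      connecting k K m (Nat.le_of_succ_le hm) (i - 1) j (by rw [h]; push_cast; ring)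

theorem connecting_naturality {K L : Filtration.{v} n} (φ : ChainMap k K L) (m : ℕ) (hm : m ≤ n)
    (i j : ℤ) (h : i = j + m) :
    connecting k K m hm i j h ≫
        HomologicalComplex.homologyMap ((Support.orthant n 0).complexMap φ) j =
      HomologicalComplex.homologyMap ((Support.orthant n m).complexMap φ) i ≫
        connecting k L m hm i j h := by
  induction m generalizing i with
  | zero =>
    obtain rfl : i = j := by simpa using h
    simp [connecting]
  | succ m ih =>
    have hδ := HomologicalComplex.HomologySequence.δ_naturality
      (Support.sequenceMap (Support.isExtension_slab hm) φ)
      (Support.sequence_shortExact _ K) (Support.sequence_shortExact _ L) i (i - 1)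
      (sub_add_cancel i 1)
    exact (comm_sq_paste hδ.symm
      (ih (Nat.le_of_succ_le hm) (i - 1) (by rw [h]; push_cast; ring)).symm).symm

/-- The connecting map out of degree `i` sits between the slab homologies in degrees `i` and `i -
1`, and both must vanish. Degree `i` corresponds to `j + 1` in `O_0`, so the induction has to treat
all `j ≥ d` together, and finiteness is needed in all degrees from `d` on. -/
theorem isIso_connecting (K : Filtration.{v} n) (d : ℤ)
    (hd : ∀ e ≥ d, FiniteSupport (((Support.orthant n 0).complex k K).homology e))
    (m : ℕ) (hm : m ≤ n) (i j : ℤ) (h : i = j + m) (hj : d ≤ j) :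
    IsIso (connecting k K m hm i j h) := by
  induction m generalizing i j with
  | zero => rw [connecting]; exact inferInstance
  | succ m ih =>
    -- The isomorphisms already built identify `H_e(O_m)` with `H_{e-m}(O_0)`, which has finite
    -- support since `e - m ≥ d`.
    have hfin : ∀ e : ℤ, d + m ≤ e →
        FiniteSupport (((Support.orthant n m).complex k K).homology e) := fun e he => by
      have he' : e = e - m + m := by ring
      have := ih (Nat.le_of_succ_le hm) e (e - m) he' (by omega)
      exact (hd (e - m) (by omega)).of_iso
        (asIso (connecting k K m (Nat.le_of_succ_le hm) e (e - m) he')).symm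
    push_cast at h
    have h1 := Support.isZero_homology_slab K hm i (hfin i (by omega))
    have h2 := Support.isZero_homology_slab K hm (i - 1) (hfin (i - 1) (by omega))
    have h3 := (Support.sequence_shortExact (k := k) (Support.isExtension_slab hm) K).isIso_δ
      i (i - 1) (sub_add_cancel i 1) h1 h2
    have h4 := ih (Nat.le_of_succ_le hm) (i - 1) j (by rw [h]; ring) hj
    rw [connecting]
    exact IsIso.comp_isIso' h3 h4

end Connecting

/-! ### The duality isomorphism -/

section Duality

variable {k : Type u} [Field k] {n : ℕ}

/-- The isomorphism between the homology of the negative orthant and the dual of the cohomology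
of `N^•`. -/
def orthantDualIso (k : Type u) [Field k] (K : Filtration.{v} n) (e : ℤ) :
    ((Support.orthant n n).complex k K).homology e ≅ dual ((K.N k).homology e) :=
  (HomologicalComplex.homologyFunctor _ _ e).mapIso (dualComplexIso k K) ≪≫
    dualHomologyIso (K.N k) e

theorem orthantDualIso_naturality {K L : Filtration.{v} n} (φ : ChainMap k K L) (e : ℤ) :
    HomologicalComplex.homologyMap ((Support.orthant n n).complexMap φ) e ≫
        (orthantDualIso k L e).hom =
      (orthantDualIso k K e).hom ≫ dualMap (HomologicalComplex.homologyMap φ.onN e) := by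
  have h1 := congrArg (fun f => HomologicalComplex.homologyMap f e) (dualComplexIso_naturality φ)
  simp only [HomologicalComplex.homologyMap_comp] at h1
  have h2 := dualHomologyIso_naturality φ.onN e
  exact comm_sq_paste h1 h2

theorem finiteSupport_orthant_zero (K : Filtration.{v} n) (d : ℤ)
    (h : ∀ e ≥ d, FiniteTotalDim (K.H k e)) (e : ℤ) (he : e ≥ d) :
    FiniteSupport (((Support.orthant n 0).complex k K).homology e) :=
  FiniteSupport.of_iso (h e he).2
    ((HomologicalComplex.homologyFunctor _ _ e).mapIso (chainsIso k K))

/-- The iterated connecting homomorphism as an isomorphism. -/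
def connectingIso (K : Filtration.{v} n) (d : ℤ) (h : ∀ e ≥ d, FiniteTotalDim (K.H k e)) :
    ((Support.orthant n n).complex k K).homology (d + n) ≅
      ((Support.orthant n 0).complex k K).homology d :=
  have := isIso_connecting K d (finiteSupport_orthant_zero K d h) n le_rfl (d + n) d rfl le_rfl
  asIso (connecting k K n le_rfl (d + n) d rfl)

theorem connectingIso_hom (K : Filtration.{v} n) (d : ℤ)
    (h : ∀ e ≥ d, FiniteTotalDim (K.H k e)) :
    (connectingIso K d h).hom = connecting k K n le_rfl (d + n) d rfl :=
  rfl

/-- The isomorphism `H_d(K_*) ≅ H^{d+n}(N^•(K_*))^*`. -/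
def dualityIso (K : Filtration.{v} n) (d : ℤ) (h : ∀ e ≥ d, FiniteTotalDim (K.H k e)) :
    K.H k d ≅ dual ((K.N k).homology (d + n)) :=
  (HomologicalComplex.homologyFunctor _ _ d).mapIso (chainsIso k K) ≪≫
    (connectingIso K d h).symm ≪≫ orthantDualIso k K (d + n)

theorem dualityIso_naturality {K L : Filtration.{v} n} (φ : ChainMap k K L) (d : ℤ)
    (hK : ∀ e ≥ d, FiniteTotalDim (K.H k e)) (hL : ∀ e ≥ d, FiniteTotalDim (L.H k e)) :
    HomologicalComplex.homologyMap φ.onChains d ≫ (dualityIso L d hL).hom =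
      (dualityIso K d hK).hom ≫ dualMap (HomologicalComplex.homologyMap φ.onN (d + n)) := by
  have h1 : HomologicalComplex.homologyMap φ.onChains d ≫
        HomologicalComplex.homologyMap (chainsIso k L).hom d =
      HomologicalComplex.homologyMap (chainsIso k K).hom d ≫
        HomologicalComplex.homologyMap ((Support.orthant n 0).complexMap φ) d := by
    rw [← HomologicalComplex.homologyMap_comp, chainsIso_naturality,
      HomologicalComplex.homologyMap_comp]
  have h2 : HomologicalComplex.homologyMap ((Support.orthant n 0).complexMap φ) d ≫
        (connectingIso L d hL).inv = (connectingIso K d hK).inv ≫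
      HomologicalComplex.homologyMap ((Support.orthant n n).complexMap φ) (d + n) := by
    rw [Iso.comp_inv_eq, Category.assoc, Iso.eq_inv_comp, connectingIso_hom, connectingIso_hom]
    exact connecting_naturality φ n le_rfl (d + n) d rfl
  have h3 := orthantDualIso_naturality φ (d + n)
  exact comm_sq_paste h1 (comm_sq_paste h2 h3)

end Duality

end MultiPers

end

theorem mainTheorem2 (k : Type u) [Field k] (n : ℕ) :
    ∃ Φ : ∀ (K : MultiPers.Filtration.{v} n) (d : ℤ),
        (∀ e ≥ d, MultiPers.FiniteTotalDim (K.H k e)) →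
          (K.H k d ≅ MultiPers.dual ((K.N k).homology (d + n))),
      ∀ (K L : MultiPers.Filtration.{v} n) (φ : MultiPers.ChainMap k K L) (d : ℤ)
        (hK : ∀ e ≥ d, MultiPers.FiniteTotalDim (K.H k e))
        (hL : ∀ e ≥ d, MultiPers.FiniteTotalDim (L.H k e)),
        HomologicalComplex.homologyMap φ.onChains d ≫ (Φ L d hL).hom =
          (Φ K d hK).hom ≫
            MultiPers.dualMap (HomologicalComplex.homologyMap φ.onN (d + n)) :=
  ⟨fun K d h => MultiPers.dualityIso K d h, fun _ _ φ d hK hL =>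
    MultiPers.dualityIso_naturality φ d hK hL⟩
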